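/- Setting. Let $\mathcal{F}$ be a finite set of features, $\mathcal{X}=\mathbb{R}^{\mathcal{F}}$, let $\mathcal{T}$ be a standard Borel space (the time domain), and let $(P_T,\mathcal{D}_t)$ be a distribution process, i.e. a probability measure $P_T$ on $\mathcal{T}$ and a Markov kernel $\mathcal{D}$ from $\mathcal{T}$ to $\mathcal{X}$. It has drift if $P_T^2(\{(s,t):\mathcal{D}_s\neq\mathcal{D}_t\})>0$. Add to $\mathcal{F}$ a time feature $\mathrm{t}\notin\mathcal{F}$ with values in $\mathcal{T}$, put $\overline{\mathcal{F}}=\mathcal{F}\sqcup\{\mathrm{t}\}$, and write $X_{\mathrm{t}}=T$ and, for $S\subseteq\overline{\mathcal{F}}$, $\overline{\mathcal{X}}_S$ for the product of the value spaces of the features in $S$. An experiment with intervention $E$ consists of a Markov kernel $E_S$ from $\overline{\mathcal{X}}_S$ to $\overline{\mathcal{X}}_{\overline{\mathcal{F}}\setminus S}$ for every $S\subseteq\overline{\mathcal{F}}$. A set $S$ is causeless if, for $E_\emptyset|_{\overline{\mathcal{X}}_S}$-a.e. $x$, $E_S(x,\cdot)$ is the regular conditional distribution of the remaining features given $X_S=x$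 under $E_\emptyset$. A Bayes network $(G,P_f)$ is a directed acyclic graph $G$ on $\overline{\mathcal{F}}$ with a Markov kernel $P_f$ from $\overline{\mathcal{X}}_{\mathrm{pa}(f)}$ to the value space of $f$ for every node $f$; $P_G$ is the joint distribution obtained by sampling the nodes successively from these kernels, and $\mathrm{do}(X_S=x)$ removes all edges into $S$ and fixes $X_S=x$. The network is a causal model of $E$ if for all $S\subseteq\overline{\mathcal{F}}$ and $E_\emptyset|_{\overline{\mathcal{X}}_S}$-a.e. $x$ one has $P_G(A\mid\mathrm{do}(X_S=x))=E_S(x,A)$ for all measurable $A\subseteq\overline{\mathcal{X}}_{\overline{\mathcal{F}}\setminus S}$. It is faithful if, for disjoint sets $A,B,C$ of nodes, $X_A\perp\!\!\!\perp X_B\mid X_C$ under $P_G$ implies that $C$ d-separates $A$ and $B$ in $G$. Theorem. Assume that $E_\emptyset(A\times W)=\int_W\mathcal{D}_t(A)\,dP_T(t)$ for all measurable $A\subseteq\mathcal{X}$ and $W\subseteq\mathcal{T}$, that $\{\mathrm{t}\}$ is causeless in $E$, and that $(G,P_f)$ is a faithful causal model of $E$. Call $F\subseteq\mathcal{F}$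 drift-reversing if for all measurable $A\subseteq\mathcal{X}_{\mathcal{F}\setminus F}$, $B\subseteq\mathcal{X}_F$, $W\subseteq\mathcal{T}$ and $P_T$-a.e. $t$ $$\int_B E_F(x,A\times W)\,d(\mathcal{D}_t|_{\mathcal{X}_F})(x)=E_{\{\mathrm{t}\}}(t,A\times B)\,P_T(W).$$ Then: 1. the node $\mathrm{t}$ has no parents in $G$; 2. the node $\mathrm{t}$ has children in $G$ if and only if $\mathcal{D}_t$ has drift; 3. every drift-reversing set $F\subseteq\mathcal{F}$ contains all children of $\mathrm{t}$; 4. the set consisting of all children of $\mathrm{t}$ and all their ancestors, without $\mathrm{t}$ itself, is drift-reversing. -/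

import Mathlib

open MeasureTheory ProbabilityTheory

/-! ### Directed acyclic graphs and d-separation -/

namespace Digraph

/-- A directed graph is acyclic if no node is reached from itself by a nonempty directed path. -/
def IsAcyclic {V : Type*} (G : Digraph V) : Prop := ∀ v, ¬ Relation.TransGen G.Adj v v

/-- The undirected graph underlying a directed graph. -/
def skeleton {V : Type*} (G : Digraph V) : SimpleGraph V where
  Adj u v := u ≠ v ∧ (G.Adj u v ∨ G.Adj v u)
  symm := ⟨fun _ _ h => ⟨h.1.symm, h.2.symm⟩⟩
  loopless := ⟨fun _ h => h.1 rfl⟩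

/-- The inner node `b` of a stretch `a - b - c` of a path is open given `C`: if `b` is a collider
(`a → b ← c`), then `b` or one of its descendants lies in `C`; otherwise `b` is not in `C`. -/
def IsOpenTriple {V : Type*} (G : Digraph V) (C : Set V) (a b c : V) : Prop :=
  ((G.Adj a b ∧ G.Adj c b) → ∃ d ∈ C, Relation.ReflTransGen G.Adj b d) ∧
  (¬ (G.Adj a b ∧ G.Adj c b) → b ∉ C)

/-- `C` d-separates `A` and `B`: every path of the skeleton from `A` to `B` is blocked by `C`,
that is, it has an inner node that is not open given `C`. -/
def DSeparates {V : Type*} (G : Digraph V) (A B C : Set V) : Prop :=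
  ∀ a ∈ A, ∀ b ∈ B, ∀ p : G.skeleton.Walk a b, p.IsPath →
    ¬ ∀ i : ℕ, i + 2 ≤ p.length →
      G.IsOpenTriple C (p.getVert i) (p.getVert (i + 1)) (p.getVert (i + 2))

/-- A topological order: a list of all nodes, without repetition, in which no node is preceded
by one of its children. -/
structure IsTopologicalOrder {V : Type*} (G : Digraph V) (l : List V) : Prop where
  nodup : l.Nodup
  mem : ∀ v, v ∈ l
  pairwise : l.Pairwise (fun u v => ¬ G.Adj v u)

theorem IsAcyclic.exists_isTopologicalOrder {V : Type*} [Finite V] {G : Digraph V}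
    (hG : G.IsAcyclic) : ∃ l : List V, G.IsTopologicalOrder l := by
  classical
  have : Fintype V := Fintype.ofFinite V
  have htr : IsTrans V (Relation.TransGen G.Adj) := ⟨fun _ _ _ => Relation.TransGen.trans⟩
  have hir : Std.Irrefl (Relation.TransGen G.Adj) := ⟨hG⟩
  have hwf : WellFounded (Relation.TransGen G.Adj) := Finite.wellFounded_of_trans_of_irrefl _
  have key : ∀ s : Finset V, ∃ l : List V, l.Nodup ∧ (∀ v, v ∈ l ↔ v ∈ s) ∧
      l.Pairwise (fun u v => ¬ G.Adj v u) := by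
    intro s
    induction s using Finset.strongInduction with
    | H s ih =>
      rcases s.eq_empty_or_nonempty with rfl | hs
      · exact ⟨[], by simp⟩
      · obtain ⟨v, hv, hmin⟩ := hwf.has_min (s : Set V) hs
        obtain ⟨l, h1, h2, h3⟩ := ih (s.erase v) (Finset.erase_ssubset hv)
        refine ⟨v :: l, ?_, ?_, ?_⟩
        · exact List.nodup_cons.2 ⟨by simp [h2], h1⟩
        · intro w
          by_cases hw : w = v
          · subst hw; simpa using hv
          · simp [h2, hw]
        · refine List.pairwise_cons.2 ⟨fun u hu hadj => ?_, h3⟩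
          exact hmin u (Finset.mem_of_mem_erase ((h2 u).1 hu)) (.single hadj)
  obtain ⟨l, h1, h2, h3⟩ := key Finset.univ
  exact ⟨l, h1, by simp [h2], h3⟩

end Digraph

/-! ### Bayes networks -/

/-- A Bayes network on the nodes `V`, the node `v` taking values in `X v`: a directed acyclic graph
with, for every node, a Markov kernel from the values of its parents to its own values. -/
structure BayesNetwork {V : Type*} (X : V → Type*) [∀ v, MeasurableSpace (X v)] where
  graph : Digraph V
  acyclic : graph.IsAcyclic
  kernel : ∀ v, Kernel (∀ u : {u // graph.Adj u v}, X u) (X v)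
  markov : ∀ v, IsMarkovKernel (kernel v)

namespace BayesNetwork

variable {V : Type*} {X : V → Type*} [∀ v, MeasurableSpace (X v)]

/-- Read the values of the parents of `v`. -/
def parentValues (N : BayesNetwork X) (v : V) (x : ∀ v, X v) :
    ∀ u : {u // N.graph.Adj u v}, X u := fun u => x u

theorem measurable_parentValues (N : BayesNetwork X) (v : V) : Measurable (N.parentValues v) :=
  measurable_pi_lambda _ fun u => measurable_pi_apply u.1

open Classical in
/-- One sampling step: draw a value for `v` from the kernel of `v` at the current values of the
parents of `v`, and write it into the coordinate `v`. -/
noncomputable def step (N : BayesNetwork X) (v : V) : Kernel (∀ v, X v) (∀ v, X v) :=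
  (Kernel.id ×ₖ (N.kernel v).comap (N.parentValues v) (N.measurable_parentValues v)).map
    (fun p => Function.update p.1 v p.2)

open Classical in
theorem isMarkovKernel_step (N : BayesNetwork X) (v : V) : IsMarkovKernel (N.step v) := by
  have := N.markov v
  unfold step
  exact Kernel.IsMarkovKernel.map _ measurable_update'

/-- Sample the nodes of a list one after the other, starting from the distribution `μ`. -/
noncomputable def sample (N : BayesNetwork X) (l : List V) (μ : Measure (∀ v, X v)) :
    Measure (∀ v, X v) :=
  l.foldl (fun ν v => ν.bind (N.step v)) μ

theorem isProbabilityMeasure_sample (N : BayesNetwork X) (l : List V) (μ : Measure (∀ v, X v))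
    [IsProbabilityMeasure μ] : IsProbabilityMeasure (N.sample l μ) := by
  induction l generalizing μ with
  | nil => simpa [sample]
  | cons v l ih =>
    have := N.isMarkovKernel_step v
    exact ih (μ.bind (N.step v))

variable [Finite V] [∀ v, Nonempty (X v)]

/-- The joint distribution of the network: the nodes are sampled along a topological order.
Every coordinate is written once and is read only after it has been written, so neither the
starting point nor the choice of the order matters. -/
noncomputable def law (N : BayesNetwork X) : Measure (∀ v, X v) :=
  N.sample N.acyclic.exists_isTopologicalOrder.choose
    (Measure.dirac fun _ => Classical.arbitrary _)

instance (N : BayesNetwork X) : IsProbabilityMeasure N.law :=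
  N.isProbabilityMeasure_sample _ _

/-- The network is faithful: a conditional independence of its joint distribution is always a
d-separation in its graph. (The converse implication, the global Markov property, holds for every
Bayes network.) -/
def IsFaithful [∀ v, StandardBorelSpace (X v)] (N : BayesNetwork X) : Prop :=
  ∀ A B C : Set V, Disjoint A B → Disjoint A C → Disjoint B C →
    CondIndepFun (MeasurableSpace.comap (C.domRestrict : (∀ v, X v) → ∀ v : C, X v) inferInstance)
      (measurable_pi_lambda _ fun v => measurable_pi_apply v.1).comap_le
      (A.domRestrict : (∀ v, X v) → ∀ v : A, X v) (B.domRestrict : (∀ v, X v) → ∀ v : B, X v) N.law →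
    N.graph.DSeparates A B C

end BayesNetwork

namespace BayesNetwork

open Classical in
/-- The do-operator `do(X_S = x)`: all edges into `S` are removed, and every node `v` of `S` gets
the value `x v`. -/
noncomputable def doOp {V : Type*} {X : V → Type*} [∀ v, MeasurableSpace (X v)]
    (N : BayesNetwork X) (S : Set V) (x : ∀ v : S, X v) : BayesNetwork X where
  graph := { Adj := fun u v => N.graph.Adj u v ∧ v ∉ S }
  acyclic := fun v h => N.acyclic v (Relation.TransGen.mono (fun _ _ huv => huv.1) _ _ h)
  kernel v :=
    if hv : v ∈ S then Kernel.const _ (Measure.dirac (x ⟨v, hv⟩))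
    else (N.kernel v).comap (fun z u => z ⟨u.1, u.2, hv⟩)
      (measurable_pi_lambda _ fun _ => measurable_pi_apply _)
  markov v := by
    have := N.markov v
    by_cases hv : v ∈ S
    · simp only [hv, dif_pos]; infer_instance
    · simp only [hv, dif_neg, not_false_eq_true]; infer_instance

end BayesNetwork

/-! ### Experiments with interventions -/

/-- An experiment with interventions: for every set `S` of features, a Markov kernel from the
values that the features of `S` are set to, to the observed values of the other features. -/
structure Experiment {V : Type*} (X : V → Type*) [∀ v, MeasurableSpace (X v)] where
  kernel : ∀ S : Set V, Kernel (∀ v : S, X v) (∀ v : ↥Sᶜ, X v)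
  markov : ∀ S, IsMarkovKernel (kernel S)

namespace Experiment

variable {V : Type*} {X : V → Type*} [∀ v, MeasurableSpace (X v)]

/-- The not-manipulated experiment, as a distribution of all features. -/
noncomputable def observed (E : Experiment X) : Measure (∀ v, X v) :=
  (E.kernel ∅ (fun v => v.2.elim)).map (fun y v => y ⟨v, Set.notMem_empty v⟩)

instance (E : Experiment X) : IsProbabilityMeasure E.observed := by
  have := E.markov ∅
  exact Measure.isProbabilityMeasure_map
    (measurable_pi_lambda _ fun _ => measurable_pi_apply _).aemeasurable

/-- A set `S` of features is causeless: setting the features of `S` to `x` has the same outcome as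
conditioning the not-manipulated experiment on their having the values `x`. -/
def IsCauseless [Finite V] [∀ v, StandardBorelSpace (X v)] [∀ v, Nonempty (X v)]
    (E : Experiment X) (S : Set V) : Prop :=
  ∀ᵐ x ∂(E.observed.map S.domRestrict),
    E.kernel S x = condDistrib (Sᶜ.domRestrict : (∀ v, X v) → ∀ v : ↥Sᶜ, X v)
      (S.domRestrict : (∀ v, X v) → ∀ v : S, X v) E.observed x

end Experiment

/-- The network is a causal model of the experiment: it predicts the outcome of all
interventions. -/
def BayesNetwork.IsCausalModel {V : Type*} {X : V → Type*} [∀ v, MeasurableSpace (X v)]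
    [Finite V] [∀ v, Nonempty (X v)] (N : BayesNetwork X) (E : Experiment X) : Prop :=
  ∀ S : Set V, ∀ᵐ x ∂(E.observed.map S.domRestrict),
    ∀ A : Set (∀ v : ↥Sᶜ, X v), MeasurableSet A →
      (N.doOp S x).law.map Sᶜ.domRestrict A = E.kernel S x A

/-! ### Drift -/

/-- Value spaces of the features `𝓕` extended by the time node `none`: time takes values in `𝒯`,
all other features are real-valued. -/
def TimedValue {𝓕 : Type*} (𝒯 : Type) : Option 𝓕 → Type
  | none => 𝒯
  | some _ => ℝ

namespace TimedValue

variable {𝓕 : Type*} {𝒯 : Type}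

instance [h : MeasurableSpace 𝒯] : ∀ v : Option 𝓕, MeasurableSpace (TimedValue 𝒯 v)
  | none => h
  | some _ => inferInstanceAs (MeasurableSpace ℝ)

instance [MeasurableSpace 𝒯] [h : StandardBorelSpace 𝒯] :
    ∀ v : Option 𝓕, StandardBorelSpace (TimedValue 𝒯 v)
  | none => h
  | some _ => inferInstanceAs (StandardBorelSpace ℝ)

instance [h : Nonempty 𝒯] : ∀ v : Option 𝓕, Nonempty (TimedValue 𝒯 v)
  | none => h
  | some _ => inferInstanceAs (Nonempty ℝ)

/-- A time point and a data point together. -/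
def join (p : 𝒯 × (𝓕 → ℝ)) : ∀ v : Option 𝓕, TimedValue 𝒯 v
  | none => p.1
  | some f => p.2 f

theorem measurable_join [MeasurableSpace 𝒯] :
    Measurable (join : 𝒯 × (𝓕 → ℝ) → ∀ v : Option 𝓕, TimedValue 𝒯 v) := by
  refine measurable_pi_lambda _ fun v => ?_
  cases v with
  | none => exact measurable_fst
  | some f => exact (measurable_pi_apply f).comp measurable_snd

/-- A time point as a value of the set of features that consists of time only. -/
def ofTime (t : 𝒯) : ∀ v : ↥({none} : Set (Option 𝓕)), TimedValue 𝒯 (v : Option 𝓕)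
  | ⟨none, _⟩ => t
  | ⟨some _, h⟩ => absurd h (by simp)

/-- Values of the features in `F ⊆ 𝓕`, with `F` seen as a subset of the extended feature set. -/
def ofFeatures (F : Set 𝓕) (x : F → ℝ) :
    ∀ v : ↥(some '' F : Set (Option 𝓕)), TimedValue 𝒯 (v : Option 𝓕)
  | ⟨none, h⟩ => absurd h (by simp)
  | ⟨some f, h⟩ => x ⟨f, by simpa using h⟩

end TimedValue

/-- The distribution process `(P, D)` has drift: two independent time points have different
distributions with positive probability. -/
def HasDrift {𝓕 𝒯 : Type*} [MeasurableSpace 𝒯] (P : Measure 𝒯) (D : Kernel 𝒯 (𝓕 → ℝ)) : Prop :=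
  0 < P.prod P {p | D p.1 ≠ D p.2}

/-- The holistic distribution: the joint distribution of time `T ~ P` and data `X | T = t ~ D t`. -/
noncomputable def holistic {𝓕 : Type*} {𝒯 : Type} [MeasurableSpace 𝒯] (P : Measure 𝒯)
    (D : Kernel 𝒯 (𝓕 → ℝ)) : Measure (∀ v : Option 𝓕, TimedValue 𝒯 v) :=
  (P.compProd D).map TimedValue.join

/-- The set `F` of features provides a drift-reversing intervention: for all measurable `A`, `B`,
`W` and `P`-almost every `t`, `∫_B E_F(x, A × W) d(D t)_F(x) = E_time(t, A × B) P(W)`, where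
`(D t)_F` is the marginal of `D t` on the features in `F`. -/
def IsDriftReversing {𝓕 : Type*} {𝒯 : Type} [MeasurableSpace 𝒯] (P : Measure 𝒯)
    (D : Kernel 𝒯 (𝓕 → ℝ)) (E : Experiment (fun v : Option 𝓕 => TimedValue 𝒯 v))
    (F : Set 𝓕) : Prop :=
  ∀ A : Set (↥Fᶜ → ℝ), MeasurableSet A → ∀ B : Set (F → ℝ), MeasurableSet B →
  ∀ W : Set 𝒯, MeasurableSet W → ∀ᵐ t ∂P,
    ∫⁻ x in B, E.kernel (some '' F) (TimedValue.ofFeatures F x)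
        {y | (fun f : ↥Fᶜ => (y ⟨some f, fun h => f.2 (by simpa using h)⟩ : ℝ)) ∈ A ∧
          (y ⟨none, by simp⟩ : 𝒯) ∈ W} ∂((D t).map F.domRestrict)
      = E.kernel {none} (TimedValue.ofTime t)
          {y | (fun f : ↥Fᶜ => (y ⟨some f, by simp⟩ : ℝ)) ∈ A ∧
            (fun f : F => (y ⟨some f, by simp⟩ : ℝ)) ∈ B} * P W

/-! Two principles carry the theorem. First, an intervention outside a parent-closed set of nodes
leaves the law of that set alone (`lintegral_law_doOp_of_dependsOn`). Second, faithfulness forbids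
an edge between two nodes that are conditionally independent given some set of other nodes
(`IsFaithful.not_adj`). The graph meets the data in `map_law_doOp_ofTime`: since time is causeless
and the model causal, `D t` is the law of the features under `do(T = t)` for almost every `t`.

A parent of time belongs to the strict ancestors of time, a parent-closed set without time, so its
distribution under `D t` is almost surely constant. It is then independent of time and the edge is
impossible. Without drift every feature is independent of time, so time has no children. If time has
no children, the features form a parent-closed set and `D t` is almost surely constant. If `F` is
drift-reversing, the kernel of the intervention on `F` gives a conditional law of each remaining
feature given `F` that is the same at almost all times; these features are independent of time given
`F`, hence not children.

For the last claim, sample time and `F` first and the other nodes afterwards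
(`exists_lintegral_law_doOp_eq`). The later nodes do not read time directly, so averaging them out
of the indicator of `A` leaves a function `h` of the coordinates in `F` alone. It is the conditional
probability of `A` under both `do(T = t)` and `do(X_F = x)`. In the latter case time is an untouched
root and contributes the factor `P W`. -/

open scoped ENNReal

/-! ### Integration against a network by successive averaging. -/

namespace BayesNetwork

variable {V : Type*} {X : V → Type*} [∀ v, MeasurableSpace (X v)]

open Classical in
/-- The average of `f` when the coordinate `v` is drawn anew from the kernel of `v`. -/
noncomputable def average (N : BayesNetwork X) (v : V) (f : (∀ v, X v) → ℝ≥0∞)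
    (x : ∀ v, X v) : ℝ≥0∞ :=
  ∫⁻ y, f (Function.update x v y) ∂N.kernel v (N.parentValues v x)

/-- The average of `f` when the coordinates of a list are drawn anew one after the other. -/
noncomputable def listAverage (N : BayesNetwork X) (l : List V) (f : (∀ v, X v) → ℝ≥0∞) :
    (∀ v, X v) → ℝ≥0∞ :=
  l.foldr N.average f

@[simp] theorem listAverage_nil (N : BayesNetwork X) (f : (∀ v, X v) → ℝ≥0∞) :
    N.listAverage [] f = f := rfl

@[simp] theorem listAverage_cons (N : BayesNetwork X) (v : V) (l : List V)
    (f : (∀ v, X v) → ℝ≥0∞) :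
    N.listAverage (v :: l) f = N.average v (N.listAverage l f) := rfl

theorem listAverage_append (N : BayesNetwork X) (l l' : List V) (f : (∀ v, X v) → ℝ≥0∞) :
    N.listAverage (l ++ l') f = N.listAverage l (N.listAverage l' f) := by
  simp [listAverage]

open Classical in
theorem lintegral_step (N : BayesNetwork X) (v : V) {f : (∀ v, X v) → ℝ≥0∞} (hf : Measurable f)
    (x : ∀ v, X v) : ∫⁻ y, f y ∂N.step v x = N.average v f x := by
  have := N.markov v
  have hm : Measurable fun p : (∀ v, X v) × X v => Function.update p.1 v p.2 :=
    measurable_update'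
  rw [step, Kernel.lintegral_map _ hm _ hf, Kernel.lintegral_id_prod (f := fun p => f (Function.update p.1 v p.2)) (hf.comp hm)]
  rfl

theorem measurable_average (N : BayesNetwork X) (v : V) {f : (∀ v, X v) → ℝ≥0∞}
    (hf : Measurable f) : Measurable (N.average v f) := by
  have : N.average v f = fun x => ∫⁻ y, f y ∂N.step v x :=
    funext fun x => (N.lintegral_step v hf x).symm
  rw [this]
  exact hf.lintegral_kernel

theorem measurable_listAverage (N : BayesNetwork X) (l : List V) {f : (∀ v, X v) → ℝ≥0∞}
    (hf : Measurable f) : Measurable (N.listAverage l f) := by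
  induction l with
  | nil => exact hf
  | cons v l ih => exact N.measurable_average v ih

/-- Pushing measures forward is dual to pulling functions back, so the node sampled first becomes
the outermost average. All later arguments manipulate functions and the coordinates they depend on.
-/
theorem lintegral_sample (N : BayesNetwork X) (l : List V) (μ : Measure (∀ v, X v))
    {f : (∀ v, X v) → ℝ≥0∞} (hf : Measurable f) :
    ∫⁻ x, f x ∂N.sample l μ = ∫⁻ x, N.listAverage l f x ∂μ := by
  induction l generalizing μ with
  | nil => rfl
  | cons v l ih =>
    have h := N.measurable_listAverage l hf
    calc ∫⁻ x, f x ∂N.sample (v :: l) μ = ∫⁻ x, f x ∂N.sample l (μ.bind (N.step v)) := rfl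
      _ = ∫⁻ x, N.listAverage l f x ∂μ.bind (N.step v) := ih _
      _ = ∫⁻ x, ∫⁻ y, N.listAverage l f y ∂N.step v x ∂μ :=
          Measure.lintegral_bind (N.step v).aemeasurable h.aemeasurable
      _ = _ := lintegral_congr fun x => N.lintegral_step v h x

section Average

variable (N : BayesNetwork X) {f g : (∀ v, X v) → ℝ≥0∞} {U : Set V} {v w : V}

theorem dependsOn_average {U' : Set V} (hf : DependsOn f U) (hU : ∀ u ∈ U, u ≠ v → u ∈ U')
    (hv : ∀ u, N.graph.Adj u v → u ∈ U') : DependsOn (N.average v f) U' := by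
  classical
  intro x y h
  have hp : N.parentValues v x = N.parentValues v y := funext fun u => h u (hv u u.2)
  unfold average
  rw [hp]
  refine lintegral_congr fun z => hf fun u hu => ?_
  by_cases huv : u = v
  · subst huv; simp
  · simp [huv, h u (hU u hu huv)]

theorem average_eq_self (hf : DependsOn f U) (hv : v ∉ U) : N.average v f = f := by
  classical
  have := N.markov v
  funext x
  have : ∀ z, f (Function.update x v z) = f x := fun z => hf fun u hu => by
    exact Function.update_of_ne (fun h : u = v => hv (h ▸ hu)) _ _
  simp [average, this]

theorem average_mul (hg : DependsOn g U) (hv : v ∉ U) (hf : Measurable f) :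
    N.average v (fun x => g x * f x) = fun x => g x * N.average v f x := by
  classical
  funext x
  have : ∀ z, g (Function.update x v z) = g x := fun z => hg fun u hu => by
    exact Function.update_of_ne (fun h : u = v => hv (h ▸ hu)) _ _
  simp only [average, this]
  exact lintegral_const_mul _ (hf.comp (measurable_update x))

/-- Neither kernel reads the coordinate that the other one writes, so this is Tonelli's theorem. -/
theorem average_comm (hvw : v ≠ w) (h1 : ¬ N.graph.Adj v w) (h2 : ¬ N.graph.Adj w v)
    (hf : Measurable f) : N.average v (N.average w f) = N.average w (N.average v f) := by
  classical
  have := N.markov v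
  have := N.markov w
  have key : ∀ {a b : V} (x : ∀ v, X v) (z : X a), ¬ N.graph.Adj a b →
      N.parentValues b (Function.update x a z) = N.parentValues b x := by
    intro a b x z hab
    funext u
    have : (u : V) ≠ a := fun h => hab (h ▸ u.2)
    simp [parentValues, this]
  funext x
  simp only [average, key _ _ h1, key _ _ h2]
  rw [lintegral_lintegral_swap]
  · simp only [Function.update_comm hvw]
  · refine (hf.comp ?_).aemeasurable
    exact measurable_update'.comp (((measurable_update x).comp measurable_fst).prodMk measurable_snd)

theorem listAverage_eq_self {l : List V} (hf : DependsOn f U) (hl : ∀ v ∈ l, v ∉ U) :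
    N.listAverage l f = f := by
  induction l with
  | nil => rfl
  | cons v l ih =>
    rw [listAverage_cons, ih fun w hw => hl w (List.mem_cons_of_mem _ hw),
      N.average_eq_self hf (hl v List.mem_cons_self)]

theorem listAverage_mul {l : List V} (hg : DependsOn g U) (hl : ∀ v ∈ l, v ∉ U)
    (hf : Measurable f) :
    N.listAverage l (fun x => g x * f x) = fun x => g x * N.listAverage l f x := by
  induction l with
  | nil => rfl
  | cons v l ih =>
    rw [listAverage_cons, ih fun w hw => hl w (List.mem_cons_of_mem _ hw),
      N.average_mul hg (hl v List.mem_cons_self) (N.measurable_listAverage l hf)]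
    rfl

/-- Averaging keeps the functions of the coordinates in a set that is closed under parents. -/
theorem dependsOn_listAverage {l : List V} (hf : DependsOn f U)
    (hU : ∀ v ∈ l, ∀ u, N.graph.Adj u v → u ∈ U) : DependsOn (N.listAverage l f) U := by
  induction l with
  | nil => exact hf
  | cons v l ih =>
    exact N.dependsOn_average (ih fun w hw => hU w (List.mem_cons_of_mem _ hw))
      (fun u hu _ => hu) (hU v List.mem_cons_self)

/-- Each average removes its own coordinate and adds only parents, which the order and acyclicity
keep out of the remaining list. For a full topological order the result is constant. -/
theorem dependsOn_listAverage_compl {l : List V} (hl : l.Pairwise fun u v => ¬ N.graph.Adj v u)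
    (f : (∀ v, X v) → ℝ≥0∞) : DependsOn (N.listAverage l f) {v | v ∉ l} := by
  induction l with
  | nil => exact (dependsOn_univ _).mono (by simp)
  | cons v l ih =>
    rw [List.pairwise_cons] at hl
    refine N.dependsOn_average (ih hl.2) (fun u hu huv => by simp_all) fun u huv => ?_
    have h1 : u ≠ v := fun h => N.acyclic v (.single (h ▸ huv))
    have h2 : u ∉ l := fun h => hl.1 u h huv
    simp [h1, h2]

theorem listAverage_comm_average {l : List V}
    (hl : ∀ w ∈ l, w ≠ v ∧ ¬ N.graph.Adj v w ∧ ¬ N.graph.Adj w v) (hf : Measurable f) :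
    N.listAverage l (N.average v f) = N.average v (N.listAverage l f) := by
  induction l with
  | nil => rfl
  | cons w l ih =>
    obtain ⟨h1, h2, h3⟩ := hl w List.mem_cons_self
    rw [listAverage_cons, ih fun u hu => hl u (List.mem_cons_of_mem _ hu), listAverage_cons,
      N.average_comm h1 h3 h2 (N.measurable_listAverage l hf)]

theorem listAverage_perm {l l' : List V} (hn : l.Nodup) (hp : l.Perm l')
    (hl : l.Pairwise fun u v => ¬ N.graph.Adj v u) (hl' : l'.Pairwise fun u v => ¬ N.graph.Adj v u)
    (hf : Measurable f) : N.listAverage l f = N.listAverage l' f := by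
  induction l generalizing l' with
  | nil => rw [List.nil_perm.1 hp]
  | cons v l ih =>
    -- The head `v` of `l` can be moved to the front of `l'`: for `w` before `v` in `l'`, that order
    -- excludes an edge from `v` to `w`, and `l`, where `v` comes first, excludes one from `w` to
    -- `v`.
    obtain ⟨a, b, rfl⟩ := List.append_of_mem (hp.mem_iff.1 List.mem_cons_self)
    rw [List.nodup_cons] at hn
    rw [List.pairwise_cons] at hl
    have hp' : l.Perm (a ++ b) := (List.perm_cons v).1 (hp.trans List.perm_middle)
    have hab : (a ++ b).Pairwise fun u v => ¬ N.graph.Adj v u :=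
      hl'.sublist ((List.sublist_cons_self v b).append_left a)
    rw [listAverage_cons, ih hn.2 hp' hl.2 hab, listAverage_append, listAverage_append,
      listAverage_cons, N.listAverage_comm_average _ (N.measurable_listAverage b hf)]
    intro w hw
    have hwl : w ∈ l := hp'.mem_iff.2 (List.mem_append_left _ hw)
    refine ⟨fun h => hn.1 (h ▸ hwl), ?_, hl.1 w hwl⟩
    exact (List.pairwise_append.1 hl').2.2 w hw v List.mem_cons_self

end Average

/-! ### Averaging under interventions. -/

section DoOp

variable (N : BayesNetwork X)

theorem isTopologicalOrder_doOp {l : List V} (hl : N.graph.IsTopologicalOrder l) (S : Set V)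
    (s : ∀ v : S, X v) : (N.doOp S s).graph.IsTopologicalOrder l :=
  ⟨hl.nodup, hl.mem, hl.pairwise.imp fun h h' => h h'.1⟩

theorem average_doOp_of_notMem {S : Set V} (s : ∀ v : S, X v) {v : V} (hv : v ∉ S) :
    (N.doOp S s).average v = N.average v := by
  funext f x
  simp only [average, doOp, dif_neg hv]
  rfl

open Classical in
theorem average_doOp_of_mem {S : Set V} (s : ∀ v : S, X v) {v : V} (hv : v ∈ S)
    {f : (∀ v, X v) → ℝ≥0∞} (hf : Measurable f) (x : ∀ v, X v) :
    (N.doOp S s).average v f x = f (Function.update x v (s ⟨v, hv⟩)) := by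
  simp only [average, doOp, dif_pos hv]
  exact lintegral_dirac' _ (hf.comp (measurable_update x))

theorem listAverage_doOp_of_notMem {S : Set V} (s : ∀ v : S, X v) {l : List V}
    (hl : ∀ v ∈ l, v ∉ S) : (N.doOp S s).listAverage l = N.listAverage l := by
  funext f
  induction l with
  | nil => rfl
  | cons v l ih =>
    rw [listAverage_cons, listAverage_cons, ih fun w hw => hl w (List.mem_cons_of_mem _ hw),
      N.average_doOp_of_notMem s (hl v List.mem_cons_self)]

/-- Starting from a point that agrees with `s` on `S`, the averages never leave the set of such
points: a node of `S` is rewritten with its value in `s`, and any other node leaves `S` untouched.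
-/
theorem listAverage_doOp_congr {S : Set V} (s : ∀ v : S, X v) {f g : (∀ v, X v) → ℝ≥0∞}
    (hf : Measurable f) (hg : Measurable g) (c : ℝ≥0∞)
    (h : ∀ x, S.domRestrict x = s → f x = c * g x) (l : List V) (x : ∀ v, X v)
    (hx : S.domRestrict x = s) :
    (N.doOp S s).listAverage l f x = c * (N.doOp S s).listAverage l g x := by
  classical
  induction l generalizing x with
  | nil => exact h x hx
  | cons v l ih =>
    have mf := (N.doOp S s).measurable_listAverage l hf
    have mg := (N.doOp S s).measurable_listAverage l hg
    rw [listAverage_cons, listAverage_cons]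
    by_cases hv : v ∈ S
    · rw [N.average_doOp_of_mem s hv mf, N.average_doOp_of_mem s hv mg]
      refine ih _ (funext fun u => ?_)
      by_cases huv : (u : V) = v
      · subst huv; simp
      · simpa [huv] using congrFun hx u
    · rw [average, average]
      refine Eq.trans (lintegral_congr fun z => ih _ (funext fun u => ?_))
        (lintegral_const_mul _ (mg.comp (measurable_update x)))
      have huv : (u : V) ≠ v := fun h => hv (h ▸ u.2)
      simpa [huv] using congrFun hx u

end DoOp

/-! ### Joint laws, observed and intervened. -/

section Law

variable [Finite V] [∀ v, Nonempty (X v)] (N : BayesNetwork X)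

/-- The joint distribution can be computed along any topological order and from any starting
point. -/
theorem lintegral_law {l : List V} (hl : N.graph.IsTopologicalOrder l)
    {f : (∀ v, X v) → ℝ≥0∞} (hf : Measurable f) (x : ∀ v, X v) :
    ∫⁻ y, f y ∂N.law = N.listAverage l f x := by
  have hc := N.acyclic.exists_isTopologicalOrder.choose_spec
  rw [law, N.lintegral_sample _ _ hf, lintegral_dirac' _ (N.measurable_listAverage _ hf)]
  rw [N.listAverage_perm hc.nodup ((List.perm_ext_iff_of_nodup hc.nodup hl.nodup).2
    fun v => by simp [hc.mem, hl.mem]) hc.pairwise hl.pairwise hf]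
  exact N.dependsOn_listAverage_compl hl.pairwise f fun v hv => absurd (hl.mem v) hv

theorem lintegral_law_doOp_empty (s : ∀ v : (∅ : Set V), X v) {f : (∀ v, X v) → ℝ≥0∞}
    (hf : Measurable f) : ∫⁻ y, f y ∂(N.doOp ∅ s).law = ∫⁻ y, f y ∂N.law := by
  obtain ⟨l, hl⟩ := N.acyclic.exists_isTopologicalOrder
  have x : ∀ v, X v := fun v => Classical.arbitrary _
  rw [N.lintegral_law hl hf x,
    (N.doOp ∅ s).lintegral_law (N.isTopologicalOrder_doOp hl ∅ s) hf x,
    N.listAverage_doOp_of_notMem s fun v _ => Set.notMem_empty v]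

theorem law_doOp_empty (s : ∀ v : (∅ : Set V), X v) : (N.doOp ∅ s).law = N.law :=
  Measure.ext_of_lintegral _ fun _ hf => N.lintegral_law_doOp_empty s hf

/-- An intervention on `S` does not change the distribution of a set of nodes that is disjoint from
`S` and closed under parents. -/
theorem lintegral_law_doOp_of_dependsOn {S U : Set V} (s : ∀ v : S, X v) (hS : Disjoint S U)
    (hU : ∀ v ∈ U, ∀ u, N.graph.Adj u v → u ∈ U) {f : (∀ v, X v) → ℝ≥0∞} (hf : Measurable f)
    (hfU : DependsOn f U) : ∫⁻ y, f y ∂(N.doOp S s).law = ∫⁻ y, f y ∂N.law := by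
  obtain ⟨l, hl⟩ := N.acyclic.exists_isTopologicalOrder
  have x : ∀ v, X v := fun v => Classical.arbitrary _
  rw [N.lintegral_law hl hf x,
    (N.doOp S s).lintegral_law (N.isTopologicalOrder_doOp hl S s) hf x]
  -- Dependence on `U` is carried through the induction: nodes outside `U` then average trivially in
  -- both networks, and nodes in `U` keep their kernels.
  suffices ∀ l, (N.doOp S s).listAverage l f = N.listAverage l f ∧
      DependsOn (N.listAverage l f) U by rw [(this l).1]
  intro l
  induction l with
  | nil => exact ⟨rfl, hfU⟩
  | cons v l ih =>
    by_cases hv : v ∈ U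
    · exact ⟨by rw [listAverage_cons, listAverage_cons, ih.1,
        N.average_doOp_of_notMem s (hS.notMem_of_mem_right hv)],
        N.dependsOn_average ih.2 (fun u hu _ => hu) (hU v hv)⟩
    · rw [listAverage_cons, listAverage_cons, ih.1, average_eq_self _ ih.2 hv,
        average_eq_self _ ih.2 hv]
      exact ⟨rfl, ih.2⟩

/-- Under an intervention on `S` the nodes of `S` are constant. -/
theorem lintegral_law_doOp_mul {S : Set V} {f g : (∀ v, X v) → ℝ≥0∞} (hg : Measurable g)
    (hgS : DependsOn g S) (hf : Measurable f) (x : ∀ v, X v) :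
    ∫⁻ y, g y * f y ∂(N.doOp S (S.domRestrict x)).law =
      g x * ∫⁻ y, f y ∂(N.doOp S (S.domRestrict x)).law := by
  obtain ⟨l, hl⟩ := N.acyclic.exists_isTopologicalOrder
  have hl' := N.isTopologicalOrder_doOp hl S (S.domRestrict x)
  -- Any starting point is allowed; `x` already agrees with the intervention on `S`.
  rw [lintegral_law (f := fun y => g y * f y) _ hl' (hg.mul hf) x, lintegral_law _ hl' hf x]
  refine N.listAverage_doOp_congr _ (hg.mul hf) hf _ (fun y hy => ?_) l x rfl
  rw [← hgS fun v hv => congrFun hy ⟨v, hv⟩]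
  rfl

/-- Let `t` be a node without parents and let `F` contain its children, but not `t`, and be closed
under parents other than `t`. Then the distribution of the remaining nodes given the values of `F`
is the same under an intervention on `t` as under an intervention on `F`, and under the latter the
value of `t` is independent of them. -/
theorem exists_lintegral_law_doOp_eq {t : V} {F : Set V} (ht : ∀ u, ¬ N.graph.Adj u t)
    (htF : t ∉ F) (hF : ∀ v ∈ F, ∀ u, N.graph.Adj u v → u = t ∨ u ∈ F)
    (hc : ∀ v, N.graph.Adj t v → v ∈ F) {g : (∀ v, X v) → ℝ≥0∞} (hg : Measurable g)
    (hgt : DependsOn g {t}ᶜ) :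
    ∃ h : (∀ v, X v) → ℝ≥0∞, Measurable h ∧ DependsOn h F ∧
      (∀ (s : ∀ v : ({t} : Set V), X v) (b : (∀ v, X v) → ℝ≥0∞), Measurable b → DependsOn b F →
        ∫⁻ y, b y * g y ∂(N.doOp {t} s).law = ∫⁻ y, b y * h y ∂(N.doOp {t} s).law) ∧
      ∀ (x : ∀ v, X v) (w : (∀ v, X v) → ℝ≥0∞), Measurable w → DependsOn w {t} →
        ∫⁻ y, w y * g y ∂(N.doOp F (F.domRestrict x)).law = h x * ∫⁻ y, w y ∂N.law := by
  classical
  obtain ⟨l₀, hl₀⟩ := N.acyclic.exists_isTopologicalOrder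
  -- Since `insert t F` is closed under parents, moving it to the front keeps the order topological.
  set a := l₀.filter (· ∈ insert t F) with ha
  set r := l₀.filter (· ∉ insert t F) with hr
  have hrm : ∀ v ∈ r, v ≠ t ∧ v ∉ F := fun v hv => by simpa [hr, hl₀.mem] using hv
  have hl : N.graph.IsTopologicalOrder (a ++ r) := by
    refine ⟨List.nodup_append'.2 ⟨hl₀.nodup.filter _, hl₀.nodup.filter _, ?_⟩, fun v => ?_,
      List.pairwise_append.2 ⟨hl₀.pairwise.filter _, hl₀.pairwise.filter _, ?_⟩⟩
    · intro v h1 h2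
      simp only [ha, hr, List.mem_filter, decide_eq_true_eq] at h1 h2
      exact h2.2 h1.2
    · by_cases hv : v ∈ insert t F
      · exact List.mem_append_left _ (by simp only [ha, List.mem_filter, hl₀.mem, hv]; simp)
      · exact List.mem_append_right _ (by simp only [hr, List.mem_filter, hl₀.mem, hv]; simp)
    · intro u hu v hv huv
      have h2 := hrm v hv
      have h1 : u = t ∨ u ∈ F := by simpa [ha, hl₀.mem] using hu
      rcases h1 with rfl | h1
      · exact ht v huv
      · exact (hF u h1 v huv).elim h2.1 h2.2
  have hm := N.measurable_listAverage r hg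
  -- Averaging out `r` leaves at most `t` and `F`. The coordinate `t` does not enter either, because
  -- `g` ignores it and no node of `r` is a child of `t`.
  have hdF : DependsOn (N.listAverage r g) F := by
    have h1 := N.dependsOn_listAverage_compl (hl.pairwise.sublist (List.sublist_append_right a r)) g
    have h2 : DependsOn (N.listAverage r g) {t}ᶜ :=
      N.dependsOn_listAverage hgt fun v hv u huv hut => (hrm v hv).2 (hc v (hut ▸ huv))
    intro x y hxy
    have e1 : N.listAverage r g x = N.listAverage r g (Function.update x t (y t)) :=
      h2 fun v hv => (Function.update_of_ne hv _ _).symm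
    rw [e1]
    refine h1 fun v hv => ?_
    by_cases hvt : v = t
    · subst hvt; simp
    · have : v ∈ F := by
        by_contra hvF
        exact hv (by simp [hr, hl₀.mem, hvt, hvF])
      simp [hvt, hxy v this]
  -- Neither `do` on `t` nor `do` on `F` touches the kernels of `r`, so one function serves for
  -- both.
  have key : ∀ {S : Set V} (s : ∀ v : S, X v), (∀ v ∈ r, v ∉ S) → ∀ b : (∀ v, X v) → ℝ≥0∞,
      Measurable b → DependsOn b (insert t F) →
      ∫⁻ y, b y * g y ∂(N.doOp S s).law =
        ∫⁻ y, b y * N.listAverage r g y ∂(N.doOp S s).law := by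
    intro S s hS b hb hbF
    have hrb : ∀ v ∈ r, v ∉ insert t F := fun v hv => by simpa using hrm v hv
    have hl' := N.isTopologicalOrder_doOp hl S s
    have x : ∀ v, X v := fun v => Classical.arbitrary _
    rw [lintegral_law (f := fun y => b y * g y) _ hl' (hb.mul hg) x,
      lintegral_law (f := fun y => b y * N.listAverage r g y) _ hl' (hb.mul hm) x, listAverage_append,
      listAverage_append, N.listAverage_doOp_of_notMem s hS]
    congr 1
    rw [N.listAverage_mul hbF hrb hg, N.listAverage_mul hbF hrb hm,
      N.listAverage_eq_self hdF fun v hv => (hrm v hv).2]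
  refine ⟨N.listAverage r g, hm, hdF, fun s b hb hbF => ?_, fun x w hw hwt => ?_⟩
  · exact key s (fun v hv => (hrm v hv).1) b hb (hbF.mono (Set.subset_insert _ _))
  · rw [key _ (fun v hv => (hrm v hv).2) w hw (hwt.mono (by simp))]
    simp_rw [mul_comm (w _)]
    rw [N.lintegral_law_doOp_mul hm hdF hw, N.lintegral_law_doOp_of_dependsOn _
      (Set.disjoint_singleton_right.2 htF) (fun v hv u huv => absurd (hv ▸ huv) (ht u)) hw hwt]

end Law

end BayesNetwork

/-! ### Conditional independence -/

/-- If a kernel is a version of the conditional distribution of `f` given `k` on each event of a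
random variable `g`, then `g` and `f` are conditionally independent given `k`. -/
theorem condIndepFun_of_measure_inter_eq_setLIntegral {Ω α β γ : Type*} [MeasurableSpace Ω]
    [StandardBorelSpace Ω] {mγ : MeasurableSpace γ} [MeasurableSpace α] [MeasurableSpace β]
    [StandardBorelSpace α] [Nonempty α] [StandardBorelSpace β] [Nonempty β] {μ : Measure Ω}
    [IsFiniteMeasure μ] {k : Ω → γ} {g : Ω → α} {f : Ω → β} (hk : Measurable k)
    (hg : Measurable g) (hf : Measurable f) (κ : Kernel γ β) [IsFiniteKernel κ]
    (h : ∀ A, MeasurableSet A → ∀ B, MeasurableSet B → ∀ W, MeasurableSet W →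
      μ (f ⁻¹' A ∩ k ⁻¹' B ∩ g ⁻¹' W) = ∫⁻ ω in k ⁻¹' B ∩ g ⁻¹' W, κ (k ω) A ∂μ) :
    CondIndepFun (mγ.comap k) hk.comap_le g f μ := by
  refine (condIndepFun_iff_condDistrib_prod_ae_eq_prodMkRight hf hg hk).2 ?_
  -- With `W` the whole space, `κ` is the conditional law of `f` given `k`; with general `W` it is,
  -- ignoring `g`, also the one given `(k, g)`.
  have h1 : condDistrib f k μ =ᵐ[μ.map k] κ := by
    refine condDistrib_ae_eq_of_measure_eq_compProd k hf.aemeasurable (Measure.ext_prod ?_)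
    intro B A hB hA
    have := h A hA B hB Set.univ .univ
    simp only [Set.preimage_univ, Set.inter_univ] at this
    rw [Measure.map_apply (hk.prodMk hf) (hB.prod hA), Measure.compProd_apply_prod hB hA,
      setLIntegral_map hB (κ.measurable_coe hA) hk, ← this, Set.inter_comm]
    rfl
  have h2 : condDistrib f (fun ω => (k ω, g ω)) μ =ᵐ[μ.map fun ω => (k ω, g ω)]
      κ.prodMkRight α := by
    refine condDistrib_ae_eq_of_measure_eq_compProd _ hf.aemeasurable (Measure.ext_prod₃' ?_)
    intro B W A hB hW hA
    rw [Measure.map_apply ((hk.prodMk hg).prodMk hf) ((hB.prod hW).prod hA),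
      Measure.compProd_apply_prod (hB.prod hW) hA,
      setLIntegral_map (hB.prod hW) (Kernel.measurable_coe _ hA) (hk.prodMk hg)]
    have h3 : (fun ω => (k ω, g ω)) ⁻¹' (B ×ˢ W) = k ⁻¹' B ∩ g ⁻¹' W := rfl
    simp only [Kernel.prodMkRight_apply, h3]
    rw [← h A hA B hB W hW]
    congr 1
    ext ω
    simp only [Set.mem_preimage, Set.mem_prod, Set.mem_inter_iff]
    tauto
  refine h2.trans ?_
  have h4 : ∀ᵐ p ∂μ.map (fun ω => (k ω, g ω)), condDistrib f k μ p.1 = κ p.1 := by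
    have hq : Measure.QuasiMeasurePreserving (Prod.fst : γ × α → γ)
        (μ.map fun ω => (k ω, g ω)) (μ.map k) := by
      refine ⟨measurable_fst, ?_⟩
      rw [Measure.map_map measurable_fst (hk.prodMk hg)]
      exact Measure.AbsolutelyContinuous.rfl
    exact hq.ae h1
  filter_upwards [h4] with p hp
  rw [Kernel.prodMkRight_apply, Kernel.prodMkRight_apply, hp]

theorem condIndepFun_congr_measurableSpace {Ω α β : Type*} {m₁ m₂ mΩ : MeasurableSpace Ω}
    [StandardBorelSpace Ω] [MeasurableSpace α] [MeasurableSpace β] {μ : Measure Ω}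
    [IsFiniteMeasure μ] {f : Ω → α} {g : Ω → β} (h : m₁ = m₂) (h₁ : m₁ ≤ mΩ) (h₂ : m₂ ≤ mΩ)
    (hfg : CondIndepFun m₁ h₁ f g μ) : CondIndepFun m₂ h₂ f g μ := by
  subst h
  exact hfg

/-! ### Faithful networks -/

/-- A path consisting of one edge has no inner node, so nothing can block it. -/
theorem Digraph.DSeparates.not_adj {V : Type*} {G : Digraph V} {A B C : Set V}
    (h : G.DSeparates A B C) {a b : V} (ha : a ∈ A) (hb : b ∈ B) (hab : a ≠ b) :
    ¬ G.Adj a b ∧ ¬ G.Adj b a := by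
  by_contra hn
  have hadj : G.skeleton.Adj a b := ⟨hab, by tauto⟩
  refine h a ha b hb hadj.toWalk (by simpa using hab) fun i hi => ?_
  simp at hi

theorem BayesNetwork.IsFaithful.not_adj {V : Type*} {X : V → Type*} [∀ v, MeasurableSpace (X v)]
    [Finite V] [∀ v, Nonempty (X v)] [∀ v, StandardBorelSpace (X v)] {N : BayesNetwork X}
    (hN : N.IsFaithful) {μ : Measure (∀ v, X v)} [IsFiniteMeasure μ] (hμ : N.law = μ) {a b : V}
    {C : Set V} (hab : a ≠ b) (ha : a ∉ C) (hb : b ∉ C)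
    (h : CondIndepFun
      (MeasurableSpace.comap (C.domRestrict : (∀ v, X v) → ∀ v : C, X v) inferInstance)
      (measurable_pi_lambda _ fun v => measurable_pi_apply v.1).comap_le
      (Set.domRestrict {a} : (∀ v, X v) → ∀ v : ({a} : Set V), X v)
      (Set.domRestrict {b} : (∀ v, X v) → ∀ v : ({b} : Set V), X v) μ) :
    ¬ N.graph.Adj a b ∧ ¬ N.graph.Adj b a := by
  subst hμ
  exact (hN {a} {b} C (by simpa using hab) (by simpa using ha) (by simpa using hb) h).not_adj
      rfl rfl hab

/-! ### Time and features -/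

namespace TimedValue

variable {𝓕 : Type*} {𝒯 : Type}

/-- The time coordinate. -/
def time (y : ∀ v : Option 𝓕, TimedValue 𝒯 v) : 𝒯 := y none

/-- The data coordinates. -/
def features (y : ∀ v : Option 𝓕, TimedValue 𝒯 v) : 𝓕 → ℝ := fun f => y (some f)

@[simp] theorem time_join (p : 𝒯 × (𝓕 → ℝ)) : time (join p) = p.1 := rfl

@[simp] theorem features_join (p : 𝒯 × (𝓕 → ℝ)) : features (join p) = p.2 := rfl

theorem domRestrict_join_none (p : 𝒯 × (𝓕 → ℝ)) :
    Set.domRestrict {none} (join p) = ofTime p.1 := by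
  funext ⟨v, hv⟩
  obtain rfl : v = none := hv
  rfl

theorem domRestrict_none (y : ∀ v : Option 𝓕, TimedValue 𝒯 v) :
    Set.domRestrict {none} y = ofTime (time y) := by
  funext ⟨v, hv⟩
  obtain rfl : v = none := hv
  rfl

theorem domRestrict_image_some (F : Set 𝓕) (y : ∀ v : Option 𝓕, TimedValue 𝒯 v) :
    (some '' F).domRestrict y = ofFeatures F (F.domRestrict (features y)) := by
  funext ⟨v, hv⟩
  obtain ⟨f, hf, rfl⟩ := hv
  rfl

/-- The data coordinates, read off from the values of all features except time. -/
def featuresOfCompl (y : ∀ v : ↥({none}ᶜ : Set (Option 𝓕)), TimedValue 𝒯 (v : Option 𝓕)) :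
    𝓕 → ℝ :=
  fun f => y ⟨some f, by simp⟩

/-- A value of the feature `f` as a value of the set of features that consists of `f` only. -/
def ofFeature (f : 𝓕) (r : ℝ) :
    ∀ v : ↥({some f} : Set (Option 𝓕)), TimedValue 𝒯 (v : Option 𝓕)
  | ⟨none, h⟩ => absurd h (by simp)
  | ⟨some _, _⟩ => r

theorem domRestrict_some (f : 𝓕) (y : ∀ v : Option 𝓕, TimedValue 𝒯 v) :
    Set.domRestrict {some f} y = ofFeature f (features y f) := by
  funext ⟨v, hv⟩
  obtain rfl : v = some f := hv
  rfl

variable [MeasurableSpace 𝒯]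

@[fun_prop]
theorem measurable_time : Measurable (time : (∀ v : Option 𝓕, TimedValue 𝒯 v) → 𝒯) :=
  measurable_pi_apply none

@[fun_prop]
theorem measurable_features :
    Measurable (features : (∀ v : Option 𝓕, TimedValue 𝒯 v) → 𝓕 → ℝ) :=
  measurable_pi_lambda _ fun f => measurable_pi_apply (some f)

theorem measurable_featuresOfCompl : Measurable (featuresOfCompl :
    (∀ v : ↥({none}ᶜ : Set (Option 𝓕)), TimedValue 𝒯 (v : Option 𝓕)) → 𝓕 → ℝ) :=
  measurable_pi_lambda _ fun f =>
    measurable_pi_apply (⟨some f, by simp⟩ : ({none}ᶜ : Set (Option 𝓕)))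

theorem measurable_ofTime :
    Measurable (ofTime : 𝒯 → ∀ v : ({none} : Set (Option 𝓕)), TimedValue 𝒯 (v : Option 𝓕)) := by
  refine measurable_pi_lambda _ fun ⟨v, hv⟩ => ?_
  obtain rfl : v = none := hv
  exact measurable_id

theorem measurable_ofFeatures (F : Set 𝓕) : Measurable (ofFeatures F : (F → ℝ) →
    ∀ v : (some '' F : Set (Option 𝓕)), TimedValue 𝒯 (v : Option 𝓕)) := by
  refine measurable_pi_lambda _ fun ⟨v, hv⟩ => ?_
  obtain ⟨f, hf, rfl⟩ := hv
  exact measurable_pi_apply (⟨f, hf⟩ : F)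

theorem measurable_ofFeature (f : 𝓕) : Measurable (ofFeature f : ℝ →
    ∀ v : ({some f} : Set (Option 𝓕)), TimedValue 𝒯 (v : Option 𝓕)) := by
  refine measurable_pi_lambda _ fun ⟨v, hv⟩ => ?_
  obtain rfl : v = some f := hv
  exact measurable_id

/-- Each of the two restriction maps is a measurable function of the other. This allows conditioning
on real vectors indexed by `F` while faithfulness speaks of extended features. -/
theorem comap_domRestrict_image_some (F : Set 𝓕) :
    MeasurableSpace.comap ((some '' F).domRestrict :
      (∀ v : Option 𝓕, TimedValue 𝒯 v) → ∀ v : (some '' F : Set (Option 𝓕)), TimedValue 𝒯 (v : Option 𝓕))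
      inferInstance =
    MeasurableSpace.comap (fun y : ∀ v : Option 𝓕, TimedValue 𝒯 v => F.domRestrict (features y))
      inferInstance := by
  apply le_antisymm
  · have : ((some '' F).domRestrict : (∀ v : Option 𝓕, TimedValue 𝒯 v) → _) =
        ofFeatures F ∘ fun y => F.domRestrict (features y) :=
      funext fun y => domRestrict_image_some F y
    rw [this, ← MeasurableSpace.comap_comp]
    exact MeasurableSpace.comap_mono (measurable_ofFeatures F).comap_le
  · let e : (∀ v : (some '' F : Set (Option 𝓕)), TimedValue 𝒯 (v : Option 𝓕)) → F → ℝ :=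
      fun z f => z ⟨some f, Set.mem_image_of_mem some f.2⟩
    have he : Measurable e := measurable_pi_lambda _ fun f : F => measurable_pi_apply
      (⟨some (f : 𝓕), Set.mem_image_of_mem some f.2⟩ : (some '' F : Set (Option 𝓕)))
    have h := MeasurableSpace.comap_mono (g := (some '' F).domRestrict) he.comap_le
    rwa [MeasurableSpace.comap_comp] at h

end TimedValue

open TimedValue

theorem DependsOn.indicator_one {ι : Type*} {α : ι → Type*} {s : Set (∀ i, α i)} {U : Set ι}
    (h : DependsOn (fun x => x ∈ s) U) :
    DependsOn (s.indicator (1 : (∀ i, α i) → ℝ≥0∞)) U := by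
  classical
  intro x y hxy
  have : (x ∈ s) = (y ∈ s) := h hxy
  simp only [Set.indicator_apply, this, Pi.one_apply]

theorem measurable_domRestrict_real {𝓕 : Type*} (F : Set 𝓕) :
    Measurable (F.domRestrict : (𝓕 → ℝ) → F → ℝ) :=
  measurable_pi_lambda _ fun f => measurable_pi_apply f.1

/-! ### The joint distribution of time and data. -/

section Holistic

variable {𝓕 : Type*} {𝒯 : Type} [MeasurableSpace 𝒯] (P : Measure 𝒯)
  [IsProbabilityMeasure P] (D : Kernel 𝒯 (𝓕 → ℝ)) [IsMarkovKernel D]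

instance : IsProbabilityMeasure (holistic P D) :=
  Measure.isProbabilityMeasure_map measurable_join.aemeasurable

theorem lintegral_holistic {g : (∀ v : Option 𝓕, TimedValue 𝒯 v) → ℝ≥0∞} (hg : Measurable g) :
    ∫⁻ y, g y ∂holistic P D = ∫⁻ t, ∫⁻ x, g (join (t, x)) ∂D t ∂P := by
  rw [holistic, lintegral_map hg measurable_join,
    Measure.lintegral_compProd (f := fun p => g (join p)) (hg.comp measurable_join)]

theorem holistic_apply {s : Set (∀ v : Option 𝓕, TimedValue 𝒯 v)} (hs : MeasurableSet s) :
    holistic P D s = ∫⁻ t, D t {x | join (t, x) ∈ s} ∂P := by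
  rw [← lintegral_indicator_one hs, lintegral_holistic P D (measurable_one.indicator hs)]
  refine lintegral_congr fun t => ?_
  have hm : MeasurableSet {x | join (t, x) ∈ s} := (measurable_join.comp measurable_prodMk_left) hs
  rw [← lintegral_indicator_one hm]
  rfl

variable {P D}

theorem ae_ae_of_ae_holistic {p : (∀ v : Option 𝓕, TimedValue 𝒯 v) → Prop}
    (h : ∀ᵐ y ∂holistic P D, p y) : ∀ᵐ t ∂P, ∀ᵐ x ∂D t, p (join (t, x)) :=
  Measure.ae_ae_of_ae_compProd (ae_of_ae_map measurable_join.aemeasurable h)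

/-- If the distribution of the feature `f` given the features in `F` does not depend on time, then
`f` and time are conditionally independent given `F`. -/
theorem condIndepFun_holistic [Finite 𝓕] [StandardBorelSpace 𝒯] [Nonempty 𝒯] {F : Set 𝓕} {f : 𝓕}
    (κ : Kernel (F → ℝ) ℝ) [IsFiniteKernel κ]
    (h : ∀ A, MeasurableSet A → ∀ B, MeasurableSet B → ∀ᵐ t ∂P,
      D t {x | x f ∈ A ∧ F.domRestrict x ∈ B} =
        ∫⁻ x in B, κ x A ∂(D t).map F.domRestrict) :
    CondIndepFun (MeasurableSpace.comap ((some '' F).domRestrict :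
        (∀ v : Option 𝓕, TimedValue 𝒯 v) → ∀ v : (some '' F : Set (Option 𝓕)), TimedValue 𝒯 (v : Option 𝓕))
        inferInstance)
      (measurable_pi_lambda _ fun v => measurable_pi_apply v.1).comap_le
      (Set.domRestrict {none} : (∀ v : Option 𝓕, TimedValue 𝒯 v) →
        ∀ v : ({none} : Set (Option 𝓕)), TimedValue 𝒯 (v : Option 𝓕))
      (Set.domRestrict {some f} : (∀ v : Option 𝓕, TimedValue 𝒯 v) →
        ∀ v : ({some f} : Set (Option 𝓕)), TimedValue 𝒯 (v : Option 𝓕)) (holistic P D) := by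
  have hk : Measurable fun y : ∀ v : Option 𝓕, TimedValue 𝒯 v => F.domRestrict (features y) :=
    (measurable_domRestrict_real F).comp measurable_features
  have hf : Measurable fun y : ∀ v : Option 𝓕, TimedValue 𝒯 v => features y f :=
    (measurable_pi_apply f).comp measurable_features
  have key := condIndepFun_of_measure_inter_eq_setLIntegral (μ := holistic P D) hk
    measurable_time hf κ fun A hA B hB W hW => ?_
  · have h' := CondIndepFun.comp key (measurable_ofTime (𝓕 := 𝓕)) (measurable_ofFeature (𝒯 := 𝒯) f)
    convert condIndepFun_congr_measurableSpace (comap_domRestrict_image_some F).symm _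
      ((comap_domRestrict_image_some F).trans_le hk.comap_le) h' using 1
    · exact funext domRestrict_none
    · exact funext (domRestrict_some f)
  · have hkW : MeasurableSet ((fun y : ∀ v : Option 𝓕, TimedValue 𝒯 v =>
        F.domRestrict (features y)) ⁻¹' B ∩ time ⁻¹' W) := (hk hB).inter (measurable_time hW)
    have hκ := κ.measurable_coe hA
    have hκk : Measurable fun y : ∀ v : Option 𝓕, TimedValue 𝒯 v =>
        κ (F.domRestrict (features y)) A := hκ.comp hk
    rw [holistic_apply P D (((hf hA).inter (hk hB)).inter (measurable_time hW)),
      ← lintegral_indicator hkW, lintegral_holistic P D (hκk.indicator hkW)]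
    refine lintegral_congr_ae ?_
    -- The required identity is the hypothesis integrated over `t` in `W`; outside `W` both sides
    -- vanish.
    filter_upwards [h A hA B hB] with t ht
    by_cases htW : t ∈ W
    · rw [setLIntegral_map hB hκ (measurable_domRestrict_real F),
        ← lintegral_indicator (measurable_domRestrict_real F hB)] at ht
      convert ht using 1
      · simp [htW]
      · refine lintegral_congr fun x => ?_
        by_cases hx : F.domRestrict x ∈ B
        · have hm : (join (t, x) : ∀ v : Option 𝓕, TimedValue 𝒯 v) ∈
              (fun y => F.domRestrict (features y)) ⁻¹' B ∩ time ⁻¹' W := ⟨hx, htW⟩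
          rw [Set.indicator_of_mem (show x ∈ F.domRestrict ⁻¹' B from hx),
            Set.indicator_of_mem hm]
          rfl
        · rw [Set.indicator_of_notMem (show x ∉ F.domRestrict ⁻¹' B from hx),
            Set.indicator_of_notMem fun h => hx h.1]
    · simp [htW]

end Holistic

/-- Intervening on the empty set changes nothing, and its only value is not exceptional because the
marginal there has mass one. -/
theorem BayesNetwork.IsCausalModel.law_eq_observed {V : Type*} {X : V → Type*}
    [∀ v, MeasurableSpace (X v)] [Finite V] [∀ v, Nonempty (X v)] {E : Experiment X}
    {N : BayesNetwork X} (hN : N.IsCausalModel E) :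
    N.law = E.observed := by
  have : IsProbabilityMeasure (E.observed.map (Set.domRestrict (∅ : Set V))) :=
    Measure.isProbabilityMeasure_map
      (measurable_pi_lambda _ fun v => measurable_pi_apply v.1).aemeasurable
  obtain ⟨s, hs⟩ := (hN ∅).exists
  obtain rfl : s = fun v => v.2.elim := funext fun v => v.2.elim
  rw [N.law_doOp_empty] at hs
  have hr : Measurable ((∅ : Set V)ᶜ.domRestrict :
      (∀ v, X v) → _) :=
    measurable_pi_lambda _ fun v => measurable_pi_apply v.1
  rw [Experiment.observed, ← Measure.ext hs, Measure.map_map _ hr]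
  · exact Measure.map_id.symm
  · exact measurable_pi_lambda _ fun _ => measurable_pi_apply _

/-! ### Causal models in which time is causeless. -/

section CausalModel

variable {𝓕 : Type*} [Finite 𝓕] {𝒯 : Type} [MeasurableSpace 𝒯] [StandardBorelSpace 𝒯]
  [Nonempty 𝒯] {P : Measure 𝒯} [IsProbabilityMeasure P]
  {D : Kernel 𝒯 (𝓕 → ℝ)} [IsMarkovKernel D]
  {E : Experiment (fun v : Option 𝓕 => TimedValue 𝒯 v)}
  {N : BayesNetwork (fun v : Option 𝓕 => TimedValue 𝒯 v)}

theorem Experiment.IsCauseless.map_kernel_ofTime (hED : E.observed = holistic P D)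
    (hT : E.IsCauseless {none}) :
    ∀ᵐ t ∂P, (E.kernel {none} (ofTime t)).map featuresOfCompl = D t := by
  have hr : Measurable (Set.domRestrict {none} : (∀ v : Option 𝓕, TimedValue 𝒯 v) →
      ∀ v : ↥({none} : Set (Option 𝓕)), TimedValue 𝒯 (v : Option 𝓕)) :=
    measurable_pi_lambda _ fun v => measurable_pi_apply v.1
  have hrc : Measurable (Set.domRestrict {none}ᶜ : (∀ v : Option 𝓕, TimedValue 𝒯 v) →
      ∀ v : ↥({none}ᶜ : Set (Option 𝓕)), TimedValue 𝒯 (v : Option 𝓕)) :=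
    measurable_pi_lambda _ fun v => measurable_pi_apply v.1
  let e : (∀ v : ↥({none} : Set (Option 𝓕)), TimedValue 𝒯 (v : Option 𝓕)) → 𝒯 :=
    fun y => y ⟨none, rfl⟩
  have he : Measurable e := measurable_pi_apply (⟨none, rfl⟩ : ({none} : Set (Option 𝓕)))
  -- Both `D` and, by causelessness, the intervention on time are versions of the conditional law of
  -- the features given time.
  have h1 : condDistrib (features : (∀ v : Option 𝓕, TimedValue 𝒯 v) → 𝓕 → ℝ)
      (Set.domRestrict {none}) E.observed =ᵐ[E.observed.map (Set.domRestrict {none})]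
      D.comap e he := by
    refine condDistrib_ae_eq_of_measure_eq_compProd _ measurable_features.aemeasurable ?_
    refine Measure.ext_of_lintegral _ fun g hg => ?_
    have hg1 : Measurable fun y : ∀ v : Option 𝓕, TimedValue 𝒯 v =>
        g (Set.domRestrict {none} y, features y) := hg.comp (hr.prodMk measurable_features)
    have hg2 := hg.lintegral_kernel_prod_right' (κ := D.comap e he)
    have hg3 : Measurable fun y : ∀ v : Option 𝓕, TimedValue 𝒯 v =>
        ∫⁻ x, g (Set.domRestrict {none} y, x) ∂D.comap e he (Set.domRestrict {none} y) :=
      hg2.comp hr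
    rw [Measure.lintegral_compProd hg, lintegral_map hg (hr.prodMk measurable_features),
      lintegral_map hg2 hr, hED,
      lintegral_holistic P D hg1, lintegral_holistic P D hg3]
    refine lintegral_congr fun t => ?_
    simp only [domRestrict_join_none, features_join, Kernel.comap_apply, lintegral_const,
      measure_univ, mul_one]
    rfl
  have h2 := condDistrib_comp (mβ := MeasurableSpace.pi) (μ := E.observed) (Set.domRestrict {none} :
    (∀ v : Option 𝓕, TimedValue 𝒯 v) →
      ∀ v : ↥({none} : Set (Option 𝓕)), TimedValue 𝒯 (v : Option 𝓕)) hrc.aemeasurable measurable_featuresOfCompl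
  have h3 : ∀ᵐ s ∂E.observed.map (Set.domRestrict {none}),
      (E.kernel {none} s).map featuresOfCompl = D (e s) := by
    filter_upwards [hT, h1, h2] with s hs1 hs2 hs3
    rw [hs1, ← Kernel.map_apply _ measurable_featuresOfCompl, ← hs3]
    exact hs2
  rw [hED] at h3
  filter_upwards [ae_ae_of_ae_holistic (ae_of_ae_map hr.aemeasurable h3)] with t ht
  -- The statement involves only the time coordinate, so a single data point `x` suffices.
  obtain ⟨x, hx⟩ := ht.exists
  rwa [domRestrict_join_none] at hx

theorem BayesNetwork.IsCausalModel.map_law_doOp_ofTime (hN : N.IsCausalModel E)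
    (hED : E.observed = holistic P D) (hT : E.IsCauseless {none}) :
    ∀ᵐ t ∂P, (N.doOp {none} (ofTime t)).law.map features = D t := by
  have hr : Measurable (Set.domRestrict {none} : (∀ v : Option 𝓕, TimedValue 𝒯 v) →
      ∀ v : ↥({none} : Set (Option 𝓕)), TimedValue 𝒯 (v : Option 𝓕)) :=
    measurable_pi_lambda _ fun v => measurable_pi_apply v.1
  have hrc : Measurable (Set.domRestrict {none}ᶜ : (∀ v : Option 𝓕, TimedValue 𝒯 v) →
      ∀ v : ↥({none}ᶜ : Set (Option 𝓕)), TimedValue 𝒯 (v : Option 𝓕)) :=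
    measurable_pi_lambda _ fun v => measurable_pi_apply v.1
  have h := hN {none}
  rw [hED] at h
  filter_upwards [hT.map_kernel_ofTime hED,
    ae_ae_of_ae_holistic (ae_of_ae_map hr.aemeasurable h)] with t h1 h2
  obtain ⟨x, hx⟩ := h2.exists
  rw [domRestrict_join_none] at hx
  rw [← h1, ← Measure.ext hx, Measure.map_map measurable_featuresOfCompl hrc]
  rfl

/-- The distribution of a feature that is not a descendant of time does not depend on time. -/
theorem BayesNetwork.IsCausalModel.ae_measure_eq (hN : N.IsCausalModel E)
    (hED : E.observed = holistic P D) (hT : E.IsCauseless {none}) {U : Set (Option 𝓕)}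
    (hU : ∀ v ∈ U, ∀ u, N.graph.Adj u v → u ∈ U) (hnU : none ∉ U) {s : Set (𝓕 → ℝ)}
    (hs : MeasurableSet s)
    (hsU : ∀ x y : ∀ v : Option 𝓕, TimedValue 𝒯 v, (∀ v ∈ U, x v = y v) →
      (features x ∈ s ↔ features y ∈ s)) :
    ∀ᵐ t ∂P, D t s = N.law.map features s := by
  classical
  filter_upwards [hN.map_law_doOp_ofTime hED hT] with t ht
  have hm : Measurable (s.indicator (1 : (𝓕 → ℝ) → ℝ≥0∞)) := measurable_one.indicator hs
  rw [← ht, ← lintegral_indicator_one hs, lintegral_map hm measurable_features,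
    ← lintegral_indicator_one hs, lintegral_map hm measurable_features]
  refine N.lintegral_law_doOp_of_dependsOn _ (Set.disjoint_singleton_left.2 hnU) hU
    (hm.comp measurable_features) fun x y hxy => ?_
  simp only [Set.indicator, hsU x y hxy, Pi.one_apply]

/-- No edge joins time and a feature whose distribution does not depend on time. -/
theorem BayesNetwork.IsFaithful.not_adj_of_ae_eq (hF : N.IsFaithful)
    (hl : N.law = holistic P D) {f : 𝓕} (ν : Measure ℝ) [IsFiniteMeasure ν]
    (h : ∀ A, MeasurableSet A → ∀ᵐ t ∂P, D t {x | x f ∈ A} = ν A) :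
    ¬ N.graph.Adj none (some f) ∧ ¬ N.graph.Adj (some f) none := by
  refine hF.not_adj hl (C := some '' ∅) (by simp) (by simp) (by simp) ?_
  refine condIndepFun_holistic (Kernel.const _ ν) fun A hA B hB => ?_
  filter_upwards [h A hA] with t ht
  -- Conditioning is on no features: the space of their values is a single point, so `B` is empty or
  -- everything.
  rcases B.eq_empty_or_nonempty with rfl | hB
  · simp
  · obtain rfl : B = Set.univ := Subsingleton.eq_univ_of_nonempty hB
    have : IsProbabilityMeasure ((D t).map (Set.domRestrict (∅ : Set 𝓕))) :=
      Measure.isProbabilityMeasure_map (measurable_domRestrict_real ∅).aemeasurable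
    simp [ht]

theorem BayesNetwork.IsFaithful.mem_of_isDriftReversing (hF : N.IsFaithful)
    (hl : N.law = holistic P D) (hED : E.observed = holistic P D) (hT : E.IsCauseless {none})
    {F : Set 𝓕} (h : IsDriftReversing P D E F) {f : 𝓕} (hf : N.graph.Adj none (some f)) :
    f ∈ F := by
  by_contra hfF
  have := E.markov (some '' F)
  have hv : Measurable fun y : ∀ v : ↥(some '' F : Set (Option 𝓕))ᶜ, TimedValue 𝒯 (v : Option 𝓕) =>
      (y ⟨some f, by simpa using hfF⟩ : ℝ) :=
    measurable_pi_apply (⟨some f, by simpa using hfF⟩ : ↥(some '' F : Set (Option 𝓕))ᶜ)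
  refine (hF.not_adj hl (a := none) (b := some f) (C := some '' F) (by simp) (by simp)
    (by simpa using hfF) ?_).1 hf
  -- The law of `f` under the intervention on `F` mentions no time. Drift reversal, taken for all of
  -- `𝒯` and a cylinder over `f`, makes it the conditional law of `f` given `F` under almost every
  -- `D t`.
  let κ : Kernel (F → ℝ) ℝ := ((E.kernel (some '' F)).comap _ (measurable_ofFeatures F)).map
    fun y => (y ⟨some f, by simpa using hfF⟩ : ℝ)
  have : IsFiniteKernel κ := Kernel.IsFiniteKernel.map _ _
  refine condIndepFun_holistic κ fun A hA B hB => ?_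
  have hA' : MeasurableSet {y : ↥Fᶜ → ℝ | y ⟨f, hfF⟩ ∈ A} :=
    (measurable_pi_apply (⟨f, hfF⟩ : ↥Fᶜ)) hA
  filter_upwards [hT.map_kernel_ofTime hED, h _ hA' B hB Set.univ .univ] with t ht h1
  have h2 : MeasurableSet {x : 𝓕 → ℝ | x f ∈ A ∧ F.domRestrict x ∈ B} :=
    ((measurable_pi_apply f) hA).inter ((measurable_domRestrict_real F) hB)
  rw [measure_univ, mul_one] at h1
  rw [← ht, Measure.map_apply measurable_featuresOfCompl h2]
  refine h1.symm.trans ?_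
  rw [ht]
  refine lintegral_congr fun x => ?_
  rw [Kernel.map_apply' _ hv _ hA]
  exact congrArg (E.kernel (some '' F) (ofFeatures F x))
    (Set.ext fun y => and_iff_left (Set.mem_univ _))

theorem BayesNetwork.IsCausalModel.isDriftReversing (hN : N.IsCausalModel E)
    (hED : E.observed = holistic P D) (hT : E.IsCauseless {none}) {F : Set 𝓕}
    (ht : ∀ v, ¬ N.graph.Adj v none)
    (hF : ∀ f ∈ F, ∀ f', N.graph.Adj (some f') (some f) → f' ∈ F)
    (hc : ∀ f, N.graph.Adj none (some f) → f ∈ F) : IsDriftReversing P D E F := by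
  classical
  intro A hA B hB W hW
  set sA : Set (∀ v : Option 𝓕, TimedValue 𝒯 v) := {y | Fᶜ.domRestrict (features y) ∈ A} with hsA
  set sB : Set (∀ v : Option 𝓕, TimedValue 𝒯 v) := {y | F.domRestrict (features y) ∈ B} with hsB
  set sW : Set (∀ v : Option 𝓕, TimedValue 𝒯 v) := {y | time y ∈ W} with hsW
  have mA : MeasurableSet sA := ((measurable_domRestrict_real Fᶜ).comp measurable_features) hA
  have mB : MeasurableSet sB := ((measurable_domRestrict_real F).comp measurable_features) hB
  have mW : MeasurableSet sW := measurable_time hW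
  have dA : DependsOn (sA.indicator (1 : (∀ v : Option 𝓕, TimedValue 𝒯 v) → ℝ≥0∞)) {none}ᶜ := by
    refine DependsOn.indicator_one fun x y h => ?_
    have : features x = features y := funext fun f => h (some f) (by simp)
    simp [hsA, this]
  have dB : DependsOn (sB.indicator (1 : (∀ v : Option 𝓕, TimedValue 𝒯 v) → ℝ≥0∞)) (some '' F) := by
    refine DependsOn.indicator_one fun x y h => ?_
    have : F.domRestrict (features x) = F.domRestrict (features y) :=
      funext fun f => h (some f) ⟨f, f.2, rfl⟩
    simp [hsB, this]
  have dW : DependsOn (sW.indicator (1 : (∀ v : Option 𝓕, TimedValue 𝒯 v) → ℝ≥0∞)) {none} := by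
    refine DependsOn.indicator_one fun x y h => ?_
    have : time x = time y := h none rfl
    simp [hsW, this]
  have m1 : ∀ {s : Set (∀ v : Option 𝓕, TimedValue 𝒯 v)}, MeasurableSet s →
      Measurable (s.indicator (1 : (∀ v : Option 𝓕, TimedValue 𝒯 v) → ℝ≥0∞)) := fun hs => measurable_one.indicator hs
  have hmul : ∀ s s' : Set (∀ v : Option 𝓕, TimedValue 𝒯 v), ∀ y,
      s.indicator (1 : (∀ v : Option 𝓕, TimedValue 𝒯 v) → ℝ≥0∞) y * s'.indicator 1 y = (s ∩ s').indicator 1 y := by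
    intro s s' y
    simp [Set.indicator, ← ite_and, and_comm]
  -- With `h` the conditional probability of `A`, both sides of the claim become the integral of `h`
  -- over `B` under `D t`, times `P W`.
  obtain ⟨h, hm, hd, hi, hii⟩ := N.exists_lintegral_law_doOp_eq (t := none) (F := some '' F) ht
    (by simp) (by
      rintro _ ⟨f, hf, rfl⟩ u hu
      cases u with
      | none => exact .inl rfl
      | some f' => exact .inr ⟨f', hF f hf f' hu, rfl⟩)
    (by
      intro v hv
      cases v with
      | none => exact absurd hv (ht none)
      | some f => exact ⟨f, hc f hv, rfl⟩) (m1 mA) dA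
  have hPW : ∫⁻ y, sW.indicator 1 y ∂N.law = P W := by
    rw [lintegral_indicator_one mW, hN.law_eq_observed, hED, holistic_apply P D mW]
    have : ∀ t, D t {x | join (t, x) ∈ sW} = W.indicator 1 t := by
      intro t
      by_cases htW : t ∈ W <;> simp [hsW, htW]
    simp_rw [this]
    exact lintegral_indicator_one hW
  have hr : Measurable (Set.domRestrict (some '' F) : (∀ v : Option 𝓕, TimedValue 𝒯 v) →
      ∀ v : ↥(some '' F : Set (Option 𝓕)), TimedValue 𝒯 (v : Option 𝓕)) :=
    measurable_pi_lambda _ fun v => measurable_pi_apply v.1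
  have hrc : Measurable (Set.domRestrict (some '' F)ᶜ : (∀ v : Option 𝓕, TimedValue 𝒯 v) →
      ∀ v : ↥(some '' F : Set (Option 𝓕))ᶜ, TimedValue 𝒯 (v : Option 𝓕)) :=
    measurable_pi_lambda _ fun v => measurable_pi_apply v.1
  have hNF := hN (some '' F)
  rw [hED] at hNF
  set Q : Set (∀ v : ↥(some '' F : Set (Option 𝓕))ᶜ, TimedValue 𝒯 (v : Option 𝓕)) :=
    {y | (fun f : ↥Fᶜ => (y ⟨some f, fun h => f.2 (by simpa using h)⟩ : ℝ)) ∈ A ∧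
          (y ⟨none, by simp⟩ : 𝒯) ∈ W} with hQ
  have mQ : MeasurableSet Q := by
    refine MeasurableSet.inter ?_ ?_
    · refine (measurable_pi_lambda _ fun f : ↥Fᶜ => ?_) hA
      exact measurable_pi_apply (⟨some f, fun h => f.2 (by simpa using h)⟩ :
        ↥(some '' F : Set (Option 𝓕))ᶜ)
    · exact measurable_pi_apply (⟨none, by simp⟩ : ↥(some '' F : Set (Option 𝓕))ᶜ) hW
  have mAB : MeasurableSet {x : 𝓕 → ℝ | Fᶜ.domRestrict x ∈ A ∧ F.domRestrict x ∈ B} :=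
    ((measurable_domRestrict_real Fᶜ) hA).inter ((measurable_domRestrict_real F) hB)
  filter_upwards [hN.map_law_doOp_ofTime hED hT, hT.map_kernel_ofTime hED,
    ae_ae_of_ae_holistic (ae_of_ae_map hr.aemeasurable hNF)] with t h1 h2 h3
  have hj : Measurable fun x : 𝓕 → ℝ => (join (t, x) : ∀ v : Option 𝓕, TimedValue 𝒯 v) :=
    measurable_join.comp measurable_prodMk_left
  have hhj : Measurable fun x => h (join (t, x)) := hm.comp hj
  have hlhs : ∫⁻ x in B, E.kernel (some '' F) (ofFeatures F x) Q ∂((D t).map F.domRestrict) =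
      ∫⁻ x in F.domRestrict ⁻¹' B, h (join (t, x)) * P W ∂D t := by
    have hκ : Measurable fun x => E.kernel (some '' F) (ofFeatures F x) Q :=
      ((E.kernel _).measurable_coe mQ).comp (measurable_ofFeatures F)
    rw [setLIntegral_map hB hκ
      (measurable_domRestrict_real F)]
    refine lintegral_congr_ae (ae_restrict_of_ae ?_)
    filter_upwards [h3] with x hx
    have := hx Q mQ
    rw [Measure.map_apply hrc mQ] at this
    rw [domRestrict_image_some, features_join] at this
    rw [← this, ← features_join (t, x), ← domRestrict_image_some, ← hPW,
      ← hii (join (t, x)) _ (m1 mW) dW]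
    simp_rw [hmul]
    rw [lintegral_indicator_one (mW.inter mA), Set.inter_comm]
    rfl
  have hrhs : E.kernel {none} (ofTime t)
          {y | (fun f : ↥Fᶜ => (y ⟨some f, by simp⟩ : ℝ)) ∈ A ∧
            (fun f : F => (y ⟨some f, by simp⟩ : ℝ)) ∈ B} =
      ∫⁻ x in F.domRestrict ⁻¹' B, h (join (t, x)) ∂D t := by
    have e1 := hi (ofTime t) _ (m1 mB) dB
    simp_rw [hmul] at e1
    rw [lintegral_indicator_one (mB.inter mA)] at e1
    have e2 : E.kernel {none} (ofTime t)
          {y | (fun f : ↥Fᶜ => (y ⟨some f, by simp⟩ : ℝ)) ∈ A ∧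
            (fun f : F => (y ⟨some f, by simp⟩ : ℝ)) ∈ B} =
        D t {x : 𝓕 → ℝ | Fᶜ.domRestrict x ∈ A ∧ F.domRestrict x ∈ B} := by
      rw [← h2, Measure.map_apply measurable_featuresOfCompl mAB]
      rfl
    have e3 : D t {x : 𝓕 → ℝ | Fᶜ.domRestrict x ∈ A ∧ F.domRestrict x ∈ B} =
        (N.doOp {none} (ofTime t)).law (sB ∩ sA) := by
      rw [← h1, Measure.map_apply measurable_features mAB, Set.inter_comm]
      rfl
    rw [e2, e3, e1, ← lintegral_indicator ((measurable_domRestrict_real F) hB), ← h1,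
      lintegral_map (hhj.indicator ((measurable_domRestrict_real F) hB))
        measurable_features]
    refine lintegral_congr fun y => ?_
    -- The time coordinate may be replaced by `t` because `h` sees only `F`.
    have e4 : h (join (t, features y)) = h y := hd fun v hv => by
      obtain ⟨f, hf, rfl⟩ := hv
      rfl
    by_cases hy : y ∈ sB
    · have hy' : features y ∈ F.domRestrict ⁻¹' B := hy
      simp [hy, hy', e4]
    · have hy' : features y ∉ F.domRestrict ⁻¹' B := hy
      simp [hy, hy']
  rw [hlhs, hrhs, lintegral_mul_const _ hhj]

end CausalModel

/-! ### Absence of drift as almost sure constancy, and the main theorem. -/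

theorem ae_eq_of_not_hasDrift {𝓕 𝒯 : Type*} [MeasurableSpace 𝒯] {P : Measure 𝒯}
    [IsProbabilityMeasure P] {D : Kernel 𝒯 (𝓕 → ℝ)} (h : ¬ HasDrift P D) :
    ∃ s, ∀ᵐ t ∂P, D s = D t := by
  have h0 : ∀ᵐ p ∂P.prod P, D p.1 = D p.2 := by
    simpa [HasDrift, ae_iff] using h
  exact (Measure.ae_ae_of_ae_prod h0).exists

theorem not_hasDrift_of_ae_eq {𝓕 𝒯 : Type*} [MeasurableSpace 𝒯] {P : Measure 𝒯}
    [IsProbabilityMeasure P] {D : Kernel 𝒯 (𝓕 → ℝ)} (ν : Measure (𝓕 → ℝ))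
    (h : ∀ᵐ t ∂P, D t = ν) : ¬ HasDrift P D := by
  have h0 : ∀ᵐ p ∂P.prod P, D p.1 = D p.2 := by
    filter_upwards [Measure.quasiMeasurePreserving_fst.ae h,
      Measure.quasiMeasurePreserving_snd.ae h] with p h1 h2
    rw [h1, h2]
  simpa [HasDrift, ae_iff] using h0

theorem theorem2 {𝓕 : Type*} [Finite 𝓕] {𝒯 : Type} [MeasurableSpace 𝒯] [StandardBorelSpace 𝒯]
    [Nonempty 𝒯] (P : Measure 𝒯) [IsProbabilityMeasure P]
    (D : Kernel 𝒯 (𝓕 → ℝ)) [IsMarkovKernel D]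
    (E : Experiment (fun v : Option 𝓕 => TimedValue 𝒯 v))
    (hED : E.observed = holistic P D)
    (hT : E.IsCauseless {none})
    (N : BayesNetwork (fun v : Option 𝓕 => TimedValue 𝒯 v))
    (hN : N.IsCausalModel E) (hF : N.IsFaithful) :
    (∀ v, ¬ N.graph.Adj v none) ∧
    ((∃ v, N.graph.Adj none v) ↔ HasDrift P D) ∧
    (∀ F : Set 𝓕, IsDriftReversing P D E F → ∀ f, N.graph.Adj none (some f) → f ∈ F) ∧
    IsDriftReversing P D E
      {f | ∃ c, N.graph.Adj none (some c) ∧ Relation.ReflTransGen N.graph.Adj (some f) (some c)} := by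
  have hl : N.law = holistic P D := hN.law_eq_observed.trans hED
  have hloop : ∀ v, ¬ N.graph.Adj v v := fun v hv => N.acyclic v (.single hv)
  have hpar : ∀ v, ¬ N.graph.Adj v none := by
    intro v hv
    cases v with
    | none => exact hloop _ hv
    | some f =>
      refine (hF.not_adj_of_ae_eq hl ((N.law.map features).map fun x => x f) fun A hA => ?_).2 hv
      rw [Measure.map_apply (measurable_pi_apply f) hA]
      -- The strict ancestors of time contain the supposed parent `f`, and acyclicity keeps time out
      -- of them.
      refine hN.ae_measure_eq hED hT (U := {u | Relation.TransGen N.graph.Adj u none})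
        (fun v hv u huv => .head huv hv) (N.acyclic none) (measurable_pi_apply f hA)
        fun x y hxy => ?_
      have : features x f = features y f := hxy (some f) (.single hv)
      simp [this]
  refine ⟨hpar, ⟨?_, fun hd => ?_⟩,
    fun F hFr f hf => hF.mem_of_isDriftReversing hl hED hT hFr hf, ?_⟩
  · rintro ⟨v, hv⟩
    by_contra hd
    obtain ⟨s, hs⟩ := ae_eq_of_not_hasDrift hd
    cases v with
    | none => exact hloop _ hv
    | some f =>
      refine (hF.not_adj_of_ae_eq hl ((D s).map fun x => x f) fun A hA => ?_).1 hv
      filter_upwards [hs] with t ht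
      rw [Measure.map_apply (measurable_pi_apply f) hA, ht]
      rfl
  · by_contra! hch
    refine not_hasDrift_of_ae_eq (N.law.map features) ?_ hd
    filter_upwards [hN.map_law_doOp_ofTime hED hT] with t ht
    rw [← ht]
    refine Measure.ext_of_lintegral _ fun g hg => ?_
    rw [lintegral_map hg measurable_features, lintegral_map hg measurable_features]
    -- The set of all features is closed under parents exactly because time has no children.
    refine N.lintegral_law_doOp_of_dependsOn (U := {none}ᶜ) _ disjoint_compl_right
      (fun v _ u huv hu => hch v (hu ▸ huv)) (hg.comp measurable_features) fun x y hxy => ?_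
    have : features x = features y := funext fun f => hxy (some f) (by simp)
    rw [this]
  · refine hN.isDriftReversing hED hT hpar ?_ fun f hf => ⟨f, hf, .refl⟩
    rintro f ⟨c, hc, hfc⟩ f' hf'
    exact ⟨c, hc, .head hf' hfc⟩
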